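/- All graphs are finite, simple and undirected. The square $B^2$ of a graph $B$ is obtained from $B$ by joining any two distinct vertices at distance exactly two in $B$. If $B$ is bipartite with bipartition $(X,Y)$ into stable sets (colour classes), then the induced subgraphs $B^2[X]$ and $B^2[Y]$ are called half-squares of $B$. A bipartite graph is chordal bipartite if it has no induced cycle of length at least six. A graph is chordal if it has no induced cycle of length at least four. For $k\ge 3$, the $k$-sun is the graph on a stable set $\{s_1,\dots,s_k\}$ and a disjoint clique $\{t_1,\dots,t_k\}$, in which $s_i$ is adjacent to exactly $t_i$ and $t_{i+1}$ for $1\le i\le k$ (indices modulo $k$). A graph is strongly chordal if it is chordal and has no induced $k$-sun for any $k\ge 3$. Theorem. A graph $G$ is (isomorphic to) a half-square of some chordal bipartite graph if and only if $G$ is strongly chordal. -/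

import Mathlib

universe u v

namespace SimpleGraph

/-- The square `H²` of a graph `H`: two distinct vertices are adjacent when they are adjacent in `H`
or at distance exactly two in `H`. (`dist` is `0` between vertices in different components.) -/
def square {U : Type u} (H : SimpleGraph U) : SimpleGraph U where
  Adj x y := H.Adj x y ∨ H.dist x y = 2
  symm := ⟨fun x y h => h.imp (fun h => h.symm) (fun h => by rw [dist_comm]; exact h)⟩
  loopless := ⟨fun x h => by simp at h⟩

/-- `(X, Y)` is a bipartition of `B`: `X` and `Y` are disjoint, they cover all vertices, and every
edge has one end in `X` and the other end in `Y`. -/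
def IsBipartition {U : Type u} (B : SimpleGraph U) (X Y : Set U) : Prop :=
  B.IsBipartiteWith X Y ∧ X ∪ Y = Set.univ

/-- `G` is (isomorphic to) a half-square of the bipartite graph `B`: the subgraph of `B²` induced by
one of the colour classes of a bipartition of `B`. -/
def IsHalfSquareOf {V : Type v} {U : Type u} (G : SimpleGraph V) (B : SimpleGraph U) : Prop :=
  ∃ X Y : Set U, B.IsBipartition X Y ∧ Nonempty (G ≃g B.square.induce X)

/-- A chordal bipartite graph: a bipartite graph without induced cycles of length at least six. -/
def IsChordalBipartite {U : Type u} (B : SimpleGraph U) : Prop :=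
  B.IsBipartite ∧ ∀ n : ℕ, 6 ≤ n → ¬ (cycleGraph n).IsIndContained B

/-- A chordal graph: a graph without induced cycles of length at least four. -/
def IsChordal {V : Type u} (G : SimpleGraph V) : Prop :=
  ∀ n : ℕ, 4 ≤ n → ¬ (cycleGraph n).IsIndContained G

/-- The `k`-sun (`k ≥ 3`): the vertices `s i = Sum.inl i` form a stable set, the vertices
`t i = Sum.inr i` form a clique, and `s i` is adjacent to `t i` and `t (i + 1)`, indices being taken
modulo `k`. -/
def sun (k : ℕ) : SimpleGraph (Fin k ⊕ Fin k) where
  Adj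
    | Sum.inl _, Sum.inl _ => False
    | Sum.inl i, Sum.inr j => (j : ℕ) = i ∨ (j : ℕ) = ((i : ℕ) + 1) % k
    | Sum.inr j, Sum.inl i => (j : ℕ) = i ∨ (j : ℕ) = ((i : ℕ) + 1) % k
    | Sum.inr i, Sum.inr j => i ≠ j
  symm := ⟨by rintro (i | i) (j | j) h <;> first | exact h | exact Ne.symm h⟩
  loopless := ⟨by rintro (i | i) h <;> first | exact h | exact h rfl⟩

/-- A strongly chordal graph: a chordal graph without induced `k`-suns, `k ≥ 3`. -/
def IsStronglyChordal {V : Type u} (G : SimpleGraph V) : Prop :=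
  G.IsChordal ∧ ∀ k : ℕ, 3 ≤ k → ¬ (sun k).IsIndContained G

end SimpleGraph

/-!
Let `G` be the half-square of a chordal bipartite graph `B` on a colour class `X`, so that distinct
vertices of `X` are adjacent in `G` when they have a common neighbour in `B`. Inserting a common
neighbour into every edge of an induced cycle of `G` of length `k ≥ 4` gives an induced cycle of
length `2 * k` in `B`, because `G` has no triangle there. For an induced `k`-sun, the absence of
induced hexagons in `B` provides a common neighbour of `s i`, `t i` and `t (i + 1)`
(`IsChordalBipartite.exists_common_adj`); it is adjacent to no other `t j`, so these vertices and the
`t i` form an induced cycle of length `2 * k ≥ 6`. Both are excluded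
(`IsChordalBipartite.isStronglyChordal`).

Conversely, `G` is a half-square of the incidence graph of its vertices and its maximal cliques
(`isHalfSquareOf_relationGraph`). If `G` is strongly chordal, this incidence graph is chordal
bipartite. Consider a shortest induced cycle in it of length `2 * k ≥ 6`, with vertices `x i` and
maximal cliques `y i`. A maximal clique containing two non-consecutive `x i` but not all of them
would close a part of the cycle to a shorter one
(`IsAlternatingCycle.rel_of_rel_of_not_cyclicAdj`); as `G` is chordal, the `x i` therefore form a
clique `K` (`IsAlternatingCycle.adj_of_isChordal`). The neighbourhoods in `K` of the vertices of
`y i` are nested, since `G` has no induced four-cycle, so by maximality of `y i` some vertex `w i` of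
it is adjacent to no further vertex of `K` than the two in `y i`
(`IsAlternatingCycle.exists_not_adj`). The `w i` are pairwise non-adjacent, again because there is
no induced four-cycle, so the `w i` and `x i` induce a `k`-sun, a contradiction
(`IsStronglyChordal.not_isAlternatingCycle`).
-/

namespace SimpleGraph

/-! ### Induced cycles and induced suns indexed by natural numbers -/

/-- Cyclic adjacency of two indices below `n`, written without modular arithmetic: they are
consecutive, or they are the two extremes `0` and `n - 1`. -/
def CyclicAdj (n i j : ℕ) : Prop :=
  i + 1 = j ∨ j + 1 = i ∨ (i = 0 ∧ j + 1 = n) ∨ (j = 0 ∧ i + 1 = n)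

theorem cycleGraph_adj_iff_cyclicAdj {n : ℕ} (hn : 3 ≤ n) (i j : Fin n) :
    (cycleGraph n).Adj i j ↔ CyclicAdj n i j := by
  have hmod : ∀ a, a < 2 * n → a % n = if a < n then a else a - n := by
    intro a ha
    split_ifs with h
    · exact Nat.mod_eq_of_lt h
    · rw [Nat.mod_eq_sub_mod (by omega), Nat.mod_eq_of_lt (by omega)]
  have hi := i.isLt
  have hj := j.isLt
  rw [cycleGraph_adj', Fin.val_sub, Fin.val_sub, hmod _ (by omega), hmod _ (by omega), CyclicAdj]
  split_ifs <;> omega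

theorem cycleGraph_isIndContained_iff {W : Type*} {H : SimpleGraph W} {n : ℕ} (hn : 3 ≤ n) :
    (cycleGraph n).IsIndContained H ↔ ∃ f : ℕ → W,
      (∀ i < n, ∀ j < n, f i = f j → i = j) ∧
      ∀ i < n, ∀ j < n, (H.Adj (f i) (f j) ↔ CyclicAdj n i j) := by
  constructor
  · rintro ⟨f⟩
    have : NeZero n := ⟨by omega⟩
    refine ⟨fun i => f (Fin.ofNat n i), fun i hi j hj h => ?_, fun i hi j hj => ?_⟩
    · have := congrArg Fin.val (f.injective h)
      simpa [Nat.mod_eq_of_lt hi, Nat.mod_eq_of_lt hj] using this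
    · rw [f.map_adj_iff, cycleGraph_adj_iff_cyclicAdj hn]
      simp [Nat.mod_eq_of_lt hi, Nat.mod_eq_of_lt hj]
  · rintro ⟨f, hinj, hadj⟩
    exact ⟨⟨⟨fun i => f i, fun i j h => Fin.ext (hinj _ i.2 _ j.2 h)⟩, fun {i j} =>
      (hadj _ i.2 _ j.2).trans (cycleGraph_adj_iff_cyclicAdj hn i j).symm⟩⟩

/-- The pattern of the `k`-sun in terms of indices below `k`: the vertex `s i` of the stable set is
joined to `t i` and to its cyclic successor. -/
def SunAdj (k i j : ℕ) : Prop := j = i ∨ j = i + 1 ∨ (j = 0 ∧ i + 1 = k)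

theorem sun_index_iff {k i j : ℕ} (hi : i < k) (hj : j < k) :
    (j = i ∨ j = (i + 1) % k) ↔ SunAdj k i j := by
  unfold SunAdj
  rcases Nat.lt_or_ge (i + 1) k with h | h
  · rw [Nat.mod_eq_of_lt h]; omega
  · have : i + 1 = k := by omega
    rw [this, Nat.mod_self]; omega

theorem sun_isIndContained_iff {W : Type*} {H : SimpleGraph W} {k : ℕ} (hk : 3 ≤ k) :
    (sun k).IsIndContained H ↔ ∃ s t : ℕ → W,
      (∀ i < k, ∀ j < k, ¬ H.Adj (s i) (s j)) ∧
      (∀ i < k, ∀ j < k, (H.Adj (t i) (t j) ↔ i ≠ j)) ∧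
      (∀ i < k, ∀ j < k, (H.Adj (s i) (t j) ↔ SunAdj k i j)) := by
  constructor
  · rintro ⟨f⟩
    have : NeZero k := ⟨by omega⟩
    refine ⟨fun i => f (.inl (Fin.ofNat k i)), fun i => f (.inr (Fin.ofNat k i)),
      fun i hi j hj h => ?_, fun i hi j hj => ?_, fun i hi j hj => ?_⟩
    · rw [f.map_adj_iff] at h
      exact h
    · rw [f.map_adj_iff]
      change Fin.ofNat k i ≠ Fin.ofNat k j ↔ _
      simp [Fin.ext_iff, Nat.mod_eq_of_lt hi, Nat.mod_eq_of_lt hj]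
    · rw [f.map_adj_iff, ← sun_index_iff hi hj]
      change (Fin.ofNat k j : ℕ) = Fin.ofNat k i ∨
        (Fin.ofNat k j : ℕ) = (Fin.ofNat k i + 1 : ℕ) % k ↔ _
      simp [Nat.mod_eq_of_lt hi, Nat.mod_eq_of_lt hj]
  · rintro ⟨s, t, hss, htt, hst⟩
    refine ⟨⟨⟨Sum.elim (fun i => s i) (fun i => t i), ?_⟩, ?_⟩⟩
    -- Distinct vertices of the sun have distinct neighbourhoods in the clique part.
    · rintro (i | i) (j | j) h
      · change s i = s j at h
        have h' : ∀ m < k, SunAdj k i m ↔ SunAdj k j m := fun m hm => by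
          rw [← hst _ i.2 _ hm, ← hst _ j.2 _ hm, h]
        have hi := i.2
        have hj := j.2
        have h1 := h' i i.2
        have h2 := h' j j.2
        unfold SunAdj at h1 h2
        exact congrArg _ (Fin.ext (by omega))
      · change s i = t j at h
        refine absurd ((hst _ j.2 _ j.2).2 (Or.inl rfl)) ?_
        rw [← h]
        exact hss _ j.2 _ i.2
      · change t i = s j at h
        refine absurd ((hst _ i.2 _ i.2).2 (Or.inl rfl)) ?_
        rw [h]
        exact hss _ i.2 _ j.2
      · by_contra hne
        have : (i : ℕ) ≠ j := fun h' => hne (congrArg _ (Fin.ext h'))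
        have h2 := (htt _ i.2 _ j.2).2 this
        change t i = t j at h
        rw [h] at h2
        exact H.irrefl h2
    · rintro (i | i) (j | j)
      · exact iff_of_false (hss _ i.2 _ j.2) id
      · exact (hst _ i.2 _ j.2).trans (sun_index_iff i.2 j.2).symm
      · exact (H.adj_comm _ _).trans ((hst _ j.2 _ i.2).trans (sun_index_iff j.2 i.2).symm)
      · exact (htt _ i.2 _ j.2).trans (not_congr Fin.ext_iff.symm)

/-! ### Alternating cycles of a relation -/

/-- The rows `x 0, …, x (k - 1)` and the columns `y 0, …, y (k - 1)` of the relation `R` form an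
induced cycle `x 0, y 0, x 1, y 1, …, x (k - 1), y (k - 1)` of length `2 * k`: the only neighbours of
`y j` among the rows are `x j` and its cyclic successor. The values at indices `≥ k` play no role. -/
def IsAlternatingCycle {X Y : Type*} (R : X → Y → Prop) (k : ℕ) (x : ℕ → X) (y : ℕ → Y) : Prop :=
  ∀ i < k, ∀ j < k, (R (x i) (y j) ↔ SunAdj k j i)

theorem IsAlternatingCycle.row_injective {X Y : Type*} {R : X → Y → Prop} {k : ℕ} {x : ℕ → X}
    {y : ℕ → Y} (h : IsAlternatingCycle R k x y) (hk : 3 ≤ k) {i j : ℕ} (hi : i < k) (hj : j < k)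
    (hij : x i = x j) : i = j := by
  have h1 := h i hi i hi
  have h2 := h j hj i hi
  have h3 := h i hi j hj
  have h4 := h j hj j hj
  rw [hij] at h1 h3
  have h5 := h1.symm.trans h2
  have h6 := h3.symm.trans h4
  unfold SunAdj at h5 h6
  omega

theorem IsAlternatingCycle.column_injective {X Y : Type*} {R : X → Y → Prop} {k : ℕ} {x : ℕ → X}
    {y : ℕ → Y} (h : IsAlternatingCycle R k x y) (hk : 3 ≤ k) {i j : ℕ} (hi : i < k) (hj : j < k)
    (hij : y i = y j) : i = j := by
  have h1 := h i hi i hi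
  have h2 := h j hj i hi
  have h3 := h i hi j hj
  have h4 := h j hj j hj
  rw [hij] at h1 h2
  have h5 := h1.symm.trans h3
  have h6 := h2.symm.trans h4
  unfold SunAdj at h5 h6
  omega

theorem IsBipartiteWith.cycleGraph_isIndContained {U : Type*} {B : SimpleGraph U} {X Y : Set U}
    (hB : B.IsBipartiteWith X Y) {k : ℕ} (hk : 3 ≤ k) {x y : ℕ → U}
    (h : IsAlternatingCycle B.Adj k x y) (hx : ∀ i < k, x i ∈ X) :
    (cycleGraph (2 * k)).IsIndContained B := by
  have hy : ∀ i < k, y i ∈ Y := fun i hi =>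
    hB.mem_of_mem_adj (hx i hi) ((h i hi i hi).2 (Or.inl rfl))
  have hxx : ∀ i < k, ∀ j < k, ¬ B.Adj (x i) (x j) := fun i hi j hj hadj =>
    Set.disjoint_left.1 hB.disjoint (hx j hj) (hB.mem_of_mem_adj (hx i hi) hadj)
  have hyy : ∀ i < k, ∀ j < k, ¬ B.Adj (y i) (y j) := fun i hi j hj hadj =>
    Set.disjoint_right.1 hB.disjoint (hy j hj) (hB.symm.mem_of_mem_adj (hy i hi) hadj)
  have hxy : ∀ i < k, ∀ j < k, x i ≠ y j := fun i hi j hj e =>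
    Set.disjoint_left.1 hB.disjoint (hx i hi) (e ▸ hy j hj)
  refine (cycleGraph_isIndContained_iff (by omega)).2
    ⟨fun n => if n % 2 = 0 then x (n / 2) else y (n / 2), fun i hi j hj => ?_, fun i hi j hj => ?_⟩
  · have hi2 : i / 2 < k := by omega
    have hj2 : j / 2 < k := by omega
    dsimp only
    split_ifs with h1 h2 h2
    · intro e
      have := h.row_injective hk hi2 hj2 e
      omega
    · intro e
      exact absurd e (hxy _ hi2 _ hj2)
    · intro e
      exact absurd e.symm (hxy _ hj2 _ hi2)
    · intro e
      have := h.column_injective hk hi2 hj2 e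
      omega
  · have hi2 : i / 2 < k := by omega
    have hj2 : j / 2 < k := by omega
    have hxy1 := h _ hi2 _ hj2
    have hxy2 := h _ hj2 _ hi2
    unfold SunAdj at hxy1 hxy2
    unfold CyclicAdj
    dsimp only
    split_ifs with h1 h2 h2
    · exact iff_of_false (hxx _ hi2 _ hj2) (by omega)
    · rw [hxy1]; omega
    · rw [B.adj_comm, hxy2]; omega
    · exact iff_of_false (hyy _ hi2 _ hj2) (by omega)

/-! ### Half-squares of chordal bipartite graphs -/

theorem IsBipartiteWith.square_adj_iff {U : Type*} {B : SimpleGraph U} {X Y : Set U}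
    (hB : B.IsBipartiteWith X Y) {a b : U} (ha : a ∈ X) (hb : b ∈ X) :
    B.square.Adj a b ↔ a ≠ b ∧ ∃ c, B.Adj a c ∧ B.Adj b c := by
  have hab : ¬ B.Adj a b := fun hadj =>
    Set.disjoint_left.1 hB.disjoint hb (hB.mem_of_mem_adj ha hadj)
  have h2 : B.dist a b = 2 ↔ B.edist a b = 2 := by
    rw [SimpleGraph.dist, ENat.toNat_eq_iff (by norm_num)]
    rfl
  change B.Adj a b ∨ B.dist a b = 2 ↔ _
  rw [or_iff_right hab, h2, edist_eq_two_iff]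
  exact ⟨fun h => ⟨h.1, h.2.2⟩, fun h => ⟨h.1, hab, h.2⟩⟩

/-- Helly property: pairwise common neighbours of `a`, `b`, `c` that are not common to all three
would form an induced hexagon with them. -/
theorem IsChordalBipartite.exists_common_adj {U : Type*} {B : SimpleGraph U} {X Y : Set U}
    (hC : B.IsChordalBipartite) (hB : B.IsBipartiteWith X Y) {a b c p q r : U}
    (ha : a ∈ X) (hb : b ∈ X) (hc : c ∈ X) (hap : B.Adj a p) (hbp : B.Adj b p) (hbq : B.Adj b q)
    (hcq : B.Adj c q) (hcr : B.Adj c r) (har : B.Adj a r) :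
    ∃ d, B.Adj a d ∧ B.Adj b d ∧ B.Adj c d := by
  by_contra! hd
  have hcp := hd p hap hbp
  have haq : ¬ B.Adj a q := fun h => hd q h hbq hcq
  have hbr : ¬ B.Adj b r := fun h => hd r har h hcr
  refine hC.2 (2 * 3) le_rfl (hB.cycleGraph_isIndContained le_rfl
    (x := fun i => if i = 0 then a else if i = 1 then b else c)
    (y := fun i => if i = 0 then p else if i = 1 then q else r) ?_ ?_)
  · intro i hi j hj
    unfold SunAdj
    interval_cases i <;> interval_cases j <;> simp [*]
  · intro i hi
    split_ifs <;> assumption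

/-- Half-squares of chordal bipartite graphs are strongly chordal. An induced cycle of
the half-square lifts by inserting a common neighbour into each edge, and an induced sun lifts by
inserting, between `t i` and its successor, a common neighbour of these two and `s i`. -/
theorem IsChordalBipartite.isStronglyChordal {V U : Type*} {G : SimpleGraph V} {B : SimpleGraph U}
    (hC : B.IsChordalBipartite) (hG : G.IsHalfSquareOf B) : G.IsStronglyChordal := by
  obtain ⟨X, Y, ⟨hB, -⟩, ⟨φ⟩⟩ := hG
  have hφ : ∀ v, (φ v : U) ∈ X := fun v => (φ v).2
  have hadj : ∀ u v, G.Adj u v ↔ u ≠ v ∧ ∃ c, B.Adj (φ u) c ∧ B.Adj (φ v) c := fun u v => by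
    rw [← φ.map_adj_iff, comap_adj, Function.Embedding.subtype_apply,
      Function.Embedding.subtype_apply, hB.square_adj_iff (hφ u) (hφ v),
      Ne, Subtype.val_inj, φ.injective.eq_iff]
  constructor
  · intro n hn hcyc
    obtain ⟨f, hinj, hf⟩ := (cycleGraph_isIndContained_iff (by omega)).1 hcyc
    have hex : ∀ j, ∃ c, j < n → B.Adj (φ (f j)) c ∧
        B.Adj (φ (f (if j + 1 = n then 0 else j + 1))) c := by
      intro j
      by_cases hj : j < n
      · have := (hf j hj (if j + 1 = n then 0 else j + 1) (by split_ifs <;> omega)).2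
          (by unfold CyclicAdj; split_ifs <;> omega)
        obtain ⟨-, c, hc⟩ := (hadj _ _).1 this
        exact ⟨c, fun _ => hc⟩
      · exact ⟨φ (f 0), fun h => absurd h hj⟩
    choose y hy using hex
    refine hC.2 (2 * n) (by omega) (hB.cycleGraph_isIndContained (by omega)
      (x := fun i => φ (f i)) (y := y) ?_ fun i _ => hφ _)
    intro i hi j hj
    obtain ⟨h1, h2⟩ := hy j hj
    constructor
    · intro h
      by_contra hne
      -- A third neighbour on the cycle would close a triangle there.
      have hs : (if j + 1 = n then 0 else j + 1) < n := by split_ifs <;> omega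
      have hne1 : i ≠ j := fun e => hne (Or.inl e)
      have hne2 : i ≠ (if j + 1 = n then 0 else j + 1) := by
        unfold SunAdj at hne
        split_ifs <;> omega
      have hne3 : (if j + 1 = n then 0 else j + 1) = j + 1 ∨
          (if j + 1 = n then 0 else j + 1) = 0 ∧ j + 1 = n := by split_ifs <;> omega
      have t1 := (hf i hi j hj).1
        ((hadj _ _).2 ⟨fun e => hne1 (hinj _ hi _ hj e), y j, h, h1⟩)
      have t2 := (hf i hi _ hs).1
        ((hadj _ _).2 ⟨fun e => hne2 (hinj _ hi _ hs e), y j, h, h2⟩)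
      unfold CyclicAdj at t1 t2
      unfold SunAdj at hne
      omega
    · intro h
      by_cases hij : i = j
      · rwa [hij]
      · have : i = if j + 1 = n then 0 else j + 1 := by
          unfold SunAdj at h
          split_ifs <;> omega
        rwa [this]
  · intro k hk hsun
    obtain ⟨s, t, hss, htt, hst⟩ := (sun_isIndContained_iff hk).1 hsun
    have hex : ∀ j, ∃ c, j < k → B.Adj (φ (s j)) c ∧ B.Adj (φ (t j)) c ∧
        B.Adj (φ (t (if j + 1 = k then 0 else j + 1))) c := by
      intro j
      by_cases hj : j < k
      · have hs : (if j + 1 = k then 0 else j + 1) < k := by split_ifs <;> omega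
        obtain ⟨-, p, hp1, hp2⟩ := (hadj _ _).1 ((hst j hj j hj).2 (Or.inl rfl))
        obtain ⟨-, q, hq1, hq2⟩ := (hadj _ _).1 ((htt j hj _ hs).2 (by split_ifs <;> omega))
        obtain ⟨-, r, hr1, hr2⟩ := (hadj _ _).1 ((hst j hj _ hs).2
          (by unfold SunAdj; split_ifs <;> omega))
        obtain ⟨c, hc⟩ := hC.exists_common_adj hB (hφ _) (hφ _) (hφ _) hp1 hp2 hq1 hq2 hr2 hr1
        exact ⟨c, fun _ => hc⟩
      · exact ⟨φ (s 0), fun h => absurd h hj⟩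
    choose y hy using hex
    refine hC.2 (2 * k) (by omega) (hB.cycleGraph_isIndContained (by omega)
      (x := fun i => φ (t i)) (y := y) ?_ fun i _ => hφ _)
    intro i hi j hj
    obtain ⟨h0, h1, h2⟩ := hy j hj
    constructor
    · intro h
      refine (hst j hj i hi).1 ((hadj _ _).2 ⟨?_, y j, h0, h⟩)
      -- `s j` is no `t i`: the latter has the neighbour `s i` in the stable set.
      intro e
      refine absurd ((hst i hi i hi).2 (Or.inl rfl)) ?_
      rw [← e]
      exact hss i hi j hj
    · intro h
      by_cases hij : i = j
      · rwa [hij]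
      · have : i = if j + 1 = k then 0 else j + 1 := by
          unfold SunAdj at h
          split_ifs <;> omega
        rwa [this]

/-! ### Shortest alternating cycles -/

/-- The index obtained from `i` by moving `q` steps forward on a cycle of length `k`, for `q` and `i`
less than `k`. -/
def rotateIndex (k q i : ℕ) : ℕ := if q + i < k then q + i else q + i - k

theorem IsAlternatingCycle.rotate {X Y : Type*} {R : X → Y → Prop} {k : ℕ} {x : ℕ → X} {y : ℕ → Y}
    (h : IsAlternatingCycle R k x y) {q : ℕ} (hq : q < k) :
    IsAlternatingCycle R k (x ∘ rotateIndex k q) (y ∘ rotateIndex k q) := by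
  intro i hi j hj
  have hi' : rotateIndex k q i < k := by unfold rotateIndex; split_ifs <;> omega
  have hj' : rotateIndex k q j < k := by unfold rotateIndex; split_ifs <;> omega
  refine (h _ hi' _ hj').trans ?_
  unfold SunAdj rotateIndex
  split_ifs <;> omega

/-- In a shortest alternating cycle, a column `D` meeting two rows that are not cyclically
consecutive meets every row: around a row missed by `D`, the nearest rows met by `D` on both sides
bound an arc which `D` closes to a shorter alternating cycle. -/
theorem IsAlternatingCycle.rel_of_rel_of_not_cyclicAdj {X Y : Type*} {R : X → Y → Prop} {k : ℕ}
    {x : ℕ → X} {y : ℕ → Y} (h : IsAlternatingCycle R k x y)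
    (hmin : ∀ m, 3 ≤ m → m < k → ∀ x' y', ¬ IsAlternatingCycle R m x' y') {a b : ℕ} (ha : a < k)
    (hb : b < k) (hne : a ≠ b) (hab : ¬ CyclicAdj k a b) {D : Y} (haD : R (x a) D)
    (hbD : R (x b) D) {c : ℕ} (hc : c < k) : R (x c) D := by
  classical
  by_contra hcD
  unfold CyclicAdj at hab
  -- After a rotation the missed row has index `0`.
  have h' := h.rotate hc
  set x' := x ∘ rotateIndex k c with hx'
  set y' := y ∘ rotateIndex k c
  have h0 : ¬ R (x' 0) D := by
    simpa [hx', rotateIndex, hc] using hcD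
  have key : ∀ e, e < k → R (x e) D → ∃ e' < k, R (x' e') D ∧ (e' + c = e ∨ e' + c = e + k) := by
    intro e he heD
    refine ⟨if c ≤ e then e - c else e + k - c, by split_ifs <;> omega, ?_, by split_ifs <;> omega⟩
    have : rotateIndex k c (if c ≤ e then e - c else e + k - c) = e := by
      unfold rotateIndex
      split_ifs <;> omega
    rwa [hx', Function.comp_apply, this]
  obtain ⟨a', ha', haD', hac⟩ := key a ha haD
  obtain ⟨b', hb', hbD', hbc⟩ := key b hb hbD
  have hex : ∃ i, R (x' i) D := ⟨a', haD'⟩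
  -- The extreme rows met by `D`; the arc from `q` through `0` to `p` is closed by `D`.
  set p := Nat.find hex
  have hpD : R (x' p) D := Nat.find_spec hex
  have hpmin : ∀ i, R (x' i) D → p ≤ i := fun i hi => Nat.find_min' hex hi
  set q := Nat.findGreatest (fun i => R (x' i) D) (k - 1)
  have hqD : R (x' q) D :=
    Nat.findGreatest_spec (P := fun i => R (x' i) D) (by omega : a' ≤ k - 1) haD'
  have hqk : q ≤ k - 1 := Nat.findGreatest_le _
  have hqmax : ∀ i, i < k → R (x' i) D → i ≤ q := fun i hi hiD =>
    Nat.le_findGreatest (P := fun i => R (x' i) D) (by omega) hiD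
  clear_value p q
  have hp0 : p ≠ 0 := fun e => h0 (e ▸ hpD)
  have ha0 : a' ≠ 0 := fun e => h0 (e ▸ haD')
  have hb0 : b' ≠ 0 := fun e => h0 (e ▸ hbD')
  have hpa := hpmin _ haD'
  have hpb := hpmin _ hbD'
  have hqa := hqmax _ ha' haD'
  have hqb := hqmax _ hb' hbD'
  have hpq : p + 2 ≤ q := by omega
  have hDiff : ∀ i, i < k - q + p + 1 → (R (x' (rotateIndex k q i)) D ↔ i = 0 ∨ i = k - q + p) := by
    intro i hi
    constructor
    · intro hiD
      by_contra hne
      have h1 := hpmin _ hiD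
      have h2 := hqmax _ (by unfold rotateIndex; split_ifs <;> omega) hiD
      unfold rotateIndex at h1 h2
      split_ifs at h1 h2 <;> omega
    · rintro (rfl | rfl)
      · rwa [rotateIndex, if_pos (by omega), add_zero]
      · rwa [rotateIndex, if_neg (by omega), show q + (k - q + p) - k = p by omega]
  refine hmin (k - q + p + 1) (by omega) (by omega) (x' ∘ rotateIndex k q)
    (fun j => if j = k - q + p then D else y' (rotateIndex k q j)) ?_
  intro i hi j hj
  have hrot := h'.rotate (q := q) (by omega) i (by omega) j (by omega)
  simp only [Function.comp_apply] at hrot ⊢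
  split_ifs with hjm
  · rw [hDiff i hi]
    unfold SunAdj
    omega
  · rw [hrot]
    unfold SunAdj
    omega

/-! ### Maximal cliques of strongly chordal graphs -/

/-- The relation between the vertices of `G` and its maximal cliques, given by membership. -/
def MaximalCliqueMem {V : Type*} (G : SimpleGraph V) (v : V)
    (C : {C : Set V // Maximal G.IsClique C}) : Prop :=
  v ∈ C.1

theorem exists_maximalCliqueMem {V : Type*} [Finite V] {G : SimpleGraph V} {s : Set V}
    (hs : G.IsClique s) : ∃ C, ∀ v ∈ s, G.MaximalCliqueMem v C := by
  obtain ⟨C, hsC, hC⟩ := Finite.exists_le_maximal hs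
  exact ⟨⟨C, hC⟩, fun v hv => hsC hv⟩

theorem exists_maximalCliqueMem_pair {V : Type*} [Finite V] {G : SimpleGraph V} {u v : V}
    (h : G.Adj u v) : ∃ C, G.MaximalCliqueMem u C ∧ G.MaximalCliqueMem v C := by
  have hs : G.IsClique {u, v} := isClique_pair.2 fun _ => h
  obtain ⟨C, hC⟩ := exists_maximalCliqueMem hs
  exact ⟨C, hC u (by simp), hC v (by simp)⟩

theorem MaximalCliqueMem.adj {V : Type*} {G : SimpleGraph V} {u v : V}
    {C : {C : Set V // Maximal G.IsClique C}} (hu : G.MaximalCliqueMem u C)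
    (hv : G.MaximalCliqueMem v C) (hne : u ≠ v) : G.Adj u v :=
  C.2.1 hu hv hne

theorem exists_not_adj_of_not_maximalCliqueMem {V : Type*} {G : SimpleGraph V} {v : V}
    {C : {C : Set V // Maximal G.IsClique C}} (hv : ¬ G.MaximalCliqueMem v C) :
    ∃ w, G.MaximalCliqueMem w C ∧ ¬ G.Adj w v := by
  by_contra! hall
  have hins : G.IsClique (insert v C.1) :=
    C.2.1.insert fun w hw _ => (hall w hw).symm
  exact hv (C.2.2 hins (Set.subset_insert v C.1) (Set.mem_insert v C.1))

theorem IsChordal.not_induced_four_cycle {V : Type*} {G : SimpleGraph V} (hG : G.IsChordal)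
    {a b c d : V} (hab : G.Adj a b) (hbc : G.Adj b c) (hcd : G.Adj c d) (hda : G.Adj d a)
    (hac : ¬ G.Adj a c) (hbd : ¬ G.Adj b d) (hac' : a ≠ c) (hbd' : b ≠ d) : False := by
  refine hG 4 le_rfl ((cycleGraph_isIndContained_iff (by norm_num)).2
    ⟨fun i => if i = 0 then a else if i = 1 then b else if i = 2 then c else d, ?_, ?_⟩)
  · have h1 := hab.ne
    have h2 := hbc.ne
    have h3 := hcd.ne
    have h4 := hda.ne
    intro i hi j hj
    interval_cases i <;> interval_cases j <;> simp [*, Ne.symm, eq_comm] <;> grind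
  · have h1 := hab.symm
    have h2 := hbc.symm
    have h3 := hcd.symm
    have h4 := hda.symm
    have h5 : ¬ G.Adj c a := fun h => hac h.symm
    have h6 : ¬ G.Adj d b := fun h => hbd h.symm
    intro i hi j hj
    unfold CyclicAdj
    interval_cases i <;> interval_cases j <;> simp [*]

/-- The rows of a shortest alternating cycle of vertices and maximal cliques of a chordal graph form
a clique: otherwise they form a cycle of length at least four, which has a chord, and a maximal
clique containing the ends of the chord contains all of them. -/
theorem IsAlternatingCycle.adj_of_isChordal {V : Type*} [Finite V] {G : SimpleGraph V}
    (hG : G.IsChordal) {k : ℕ} (hk : 3 ≤ k) {x : ℕ → V}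
    {y : ℕ → {C : Set V // Maximal G.IsClique C}}
    (h : IsAlternatingCycle G.MaximalCliqueMem k x y)
    (hmin : ∀ m, 3 ≤ m → m < k → ∀ x' y', ¬ IsAlternatingCycle G.MaximalCliqueMem m x' y')
    {i j : ℕ} (hi : i < k) (hj : j < k) (hij : i ≠ j) : G.Adj (x i) (x j) := by
  have hinj : ∀ i < k, ∀ j < k, x i = x j → i = j := fun i hi j hj => h.row_injective hk hi hj
  have hcons : ∀ i < k, ∀ j < k, i ≠ j → CyclicAdj k i j → G.Adj (x i) (x j) := by
    intro i hi j hj hne hc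
    have hne' : x i ≠ x j := fun e => hne (hinj i hi j hj e)
    by_cases hs : SunAdj k i j
    · exact ((h i hi i hi).2 (Or.inl rfl)).adj ((h j hj i hi).2 hs) hne'
    · refine ((h i hi j hj).2 ?_).adj ((h j hj j hj).2 (Or.inl rfl)) hne'
      unfold CyclicAdj at hc
      unfold SunAdj at hs ⊢
      omega
  by_contra hnadj
  have hk4 : 4 ≤ k := by
    by_contra hlt
    refine hnadj (hcons i hi j hj hij ?_)
    unfold CyclicAdj
    omega
  obtain ⟨a, ha, b, hb, hab, hchord⟩ :
      ∃ a < k, ∃ b < k, G.Adj (x a) (x b) ∧ ¬ CyclicAdj k a b := by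
    by_contra! hno
    refine hG k hk4 ((cycleGraph_isIndContained_iff hk).2 ⟨x, hinj, fun i hi j hj =>
      ⟨hno i hi j hj, fun hc => hcons i hi j hj ?_ hc⟩⟩)
    unfold CyclicAdj at hc
    omega
  obtain ⟨D, haD, hbD⟩ := exists_maximalCliqueMem_pair hab
  have hD : ∀ c < k, G.MaximalCliqueMem (x c) D := fun c hc =>
    h.rel_of_rel_of_not_cyclicAdj hmin ha hb (fun e => hab.ne (congrArg x e)) hchord haD hbD hc
  exact hnadj ((hD i hi).adj (hD j hj) fun e => hij (hinj i hi j hj e))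

/-- If the rows form a clique `K`, every column `y i` has a vertex whose neighbours in `K` are only
the two rows in `y i`. Since there is no induced four-cycle, the neighbourhoods in `K` of the
vertices of the clique `y i` are nested, and by maximality of `y i` no row outside it belongs to all
of them; a vertex with the smallest neighbourhood has the desired property. -/
theorem IsAlternatingCycle.exists_not_adj {V : Type*} [Finite V] {G : SimpleGraph V}
    (hG : G.IsChordal) {k : ℕ} {x : ℕ → V} {y : ℕ → {C : Set V // Maximal G.IsClique C}}
    (h : IsAlternatingCycle G.MaximalCliqueMem k x y)
    (hK : ∀ i < k, ∀ j < k, i ≠ j → G.Adj (x i) (x j)) {i : ℕ} (hi : i < k) :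
    ∃ w, G.MaximalCliqueMem w (y i) ∧ ∀ j < k, ¬ SunAdj k i j → ¬ G.Adj w (x j) := by
  classical
  obtain ⟨w, hw, hmin⟩ := Set.exists_min_image {w | G.MaximalCliqueMem w (y i)}
    (fun w => ((Finset.range k).filter fun j => G.Adj w (x j) ∨ w = x j).card)
    (Set.toFinite _) ⟨x i, (h i hi i hi).2 (Or.inl rfl)⟩
  refine ⟨w, hw, fun j hj hij hwj => ?_⟩
  have hjC : ¬ G.MaximalCliqueMem (x j) (y i) := fun hm => hij ((h j hj i hi).1 hm)
  obtain ⟨w', hw', hwj'⟩ := exists_not_adj_of_not_maximalCliqueMem hjC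
  have hne' : w' ≠ x j := fun e => hjC (e ▸ hw')
  refine absurd (hmin w' hw') (not_le.2 (Finset.card_lt_card ?_))
  refine (Finset.ssubset_iff_of_subset fun l hl => ?_).2
    ⟨j, by simp [hj, hwj], by simp [hwj', hne']⟩
  rw [Finset.mem_filter, Finset.mem_range] at hl ⊢
  refine ⟨hl.1, ?_⟩
  by_contra! hcon
  have hlj : l ≠ j := fun e => hcon.1 (e ▸ hwj)
  have hw'l : G.Adj w' (x l) := by
    rcases hl.2 with hadj | e
    · exact hadj
    · exact absurd (e ▸ hK l hl.1 j hj hlj) hwj'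
  exact hG.not_induced_four_cycle (hw.adj hw' fun e => hwj' (e ▸ hwj)) hw'l
    (hK l hl.1 j hj hlj) hwj.symm hcon.1 hwj' hcon.2 hne'

/-- The rows of a shortest alternating cycle, together with a vertex of each column as provided by
`IsAlternatingCycle.exists_not_adj`, induce a sun. -/
theorem IsStronglyChordal.not_isAlternatingCycle {V : Type*} [Finite V] {G : SimpleGraph V}
    (hG : G.IsStronglyChordal) {k : ℕ} (hk : 3 ≤ k) (x : ℕ → V)
    (y : ℕ → {C : Set V // Maximal G.IsClique C}) :
    ¬ IsAlternatingCycle G.MaximalCliqueMem k x y := by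
  induction k using Nat.strong_induction_on generalizing x y with
  | _ k ih =>
  intro h
  have hK : ∀ i < k, ∀ j < k, i ≠ j → G.Adj (x i) (x j) := fun i hi j hj hij =>
    h.adj_of_isChordal hG.1 hk (fun m hm hmk x' y' => ih m hmk hm x' y') hi hj hij
  have hex : ∀ i, ∃ w, i < k →
      G.MaximalCliqueMem w (y i) ∧ ∀ j < k, ¬ SunAdj k i j → ¬ G.Adj w (x j) := by
    intro i
    by_cases hi : i < k
    · obtain ⟨w, hw⟩ := h.exists_not_adj hG.1 hK hi
      exact ⟨w, fun _ => hw⟩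
    · exact ⟨x 0, fun hlt => absurd hlt hi⟩
  choose w hw using hex
  have hwx : ∀ i < k, ∀ j < k, w i ≠ x j := by
    intro i hi j hj e
    obtain ⟨l, hl, hil, hlj⟩ : ∃ l < k, ¬ SunAdj k i l ∧ l ≠ j := by
      have hij : SunAdj k i j := (h j hj i hi).1 (e ▸ (hw i hi).1)
      obtain ⟨l, hl, hil⟩ : ∃ l < k, ¬ SunAdj k i l := by
        unfold SunAdj
        by_cases hi0 : i = 0
        · exact ⟨2, by omega, by omega⟩
        · exact ⟨i - 1, by omega, by omega⟩
      exact ⟨l, hl, hil, fun e => hil (e ▸ hij)⟩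
    -- As a row, `w i` would be adjacent to the row `x l`, which is not in `y i`.
    exact (hw i hi).2 l hl hil (e ▸ hK j hj l hl hlj.symm)
  have hwadj : ∀ i < k, ∀ j < k, (G.Adj (w i) (x j) ↔ SunAdj k i j) := by
    intro i hi j hj
    refine ⟨fun hadj => by_contra fun hij => (hw i hi).2 j hj hij hadj, fun hij => ?_⟩
    exact (hw i hi).1.adj ((h j hj i hi).2 hij) (hwx i hi j hj)
  have hsep : ∀ i < k, ∀ j < k, i ≠ j → ∃ a < k, SunAdj k i a ∧ ¬ SunAdj k j a := by
    intro i hi j hj hij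
    unfold SunAdj
    by_cases hji : i = j + 1 ∨ (i = 0 ∧ j + 1 = k)
    · by_cases hik : i + 1 = k
      · exact ⟨0, by omega, by omega, by omega⟩
      · exact ⟨i + 1, by omega, by omega, by omega⟩
    · exact ⟨i, hi, by omega, by omega⟩
  refine hG.2 k hk ((sun_isIndContained_iff hk).2 ⟨w, x, ?_, ?_, hwadj⟩)
  · intro i hi j hj hadj
    have hij : i ≠ j := fun e => hadj.ne (congrArg w e)
    obtain ⟨a, ha, hia, hja⟩ := hsep i hi j hj hij
    obtain ⟨b, hb, hjb, hib⟩ := hsep j hj i hi hij.symm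
    exact hG.1.not_induced_four_cycle hadj ((hwadj j hj b hb).2 hjb)
      (hK b hb a ha fun e => hib (e ▸ hia)) ((hwadj i hi a ha).2 hia).symm
      (fun e => hib ((hwadj i hi b hb).1 e)) (fun e => hja ((hwadj j hj a ha).1 e))
      (hwx i hi b hb) (hwx j hj a ha)
  · exact fun i hi j hj => ⟨fun hadj e => hadj.ne (congrArg x e), hK i hi j hj⟩

/-! ### The bipartite graph of a relation -/

/-- The bipartite graph on the disjoint union of `X` and `Y` whose edges are the pairs related
by `R`. -/
def relationGraph {X Y : Type*} (R : X → Y → Prop) : SimpleGraph (X ⊕ Y) where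
  Adj
    | Sum.inl a, Sum.inr b => R a b
    | Sum.inr b, Sum.inl a => R a b
    | _, _ => False
  symm := ⟨by rintro (a | b) (a' | b') h <;> exact h⟩
  loopless := ⟨by rintro (a | b) h <;> exact h⟩

theorem relationGraph_isBipartition {X Y : Type*} (R : X → Y → Prop) :
    (relationGraph R).IsBipartition (Set.range Sum.inl) (Set.range Sum.inr) := by
  refine ⟨⟨Set.isCompl_range_inl_range_inr.disjoint, ?_⟩, Set.range_inl_union_range_inr⟩
  rintro (a | b) (a' | b') h
  · exact h.elim
  · exact Or.inl ⟨⟨a, rfl⟩, ⟨b', rfl⟩⟩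
  · exact Or.inr ⟨⟨b, rfl⟩, ⟨a', rfl⟩⟩
  · exact h.elim

theorem relationGraph_adj_isLeft {X Y : Type*} {R : X → Y → Prop} {a b : X ⊕ Y}
    (h : (relationGraph R).Adj a b) : b.isLeft = !a.isLeft := by
  rcases a with a | a <;> rcases b with b | b
  · exact h.elim
  · rfl
  · rfl
  · exact h.elim

/-- An induced cycle of the bipartite graph of a relation, starting in the first colour class, is an
alternating cycle; its length is even because the colour classes alternate. -/
theorem exists_isAlternatingCycle_of_isLeft {X Y : Type*} {R : X → Y → Prop} {n : ℕ} (hn : 3 ≤ n)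
    {f : ℕ → X ⊕ Y}
    (hf : ∀ i < n, ∀ j < n, ((relationGraph R).Adj (f i) (f j) ↔ CyclicAdj n i j))
    (h0 : (f 0).isLeft = true) :
    ∃ k x y, n = 2 * k ∧ IsAlternatingCycle R k x y := by
  have hpar : ∀ i < n, (f i).isLeft = decide (i % 2 = 0) := by
    intro i
    induction i with
    | zero => intro _; simpa using h0
    | succ i ih =>
      intro hi
      rw [relationGraph_adj_isLeft ((hf i (by omega) (i + 1) hi).2 (Or.inl rfl)), ih (by omega)]
      have : (i + 1) % 2 = 0 ↔ ¬ i % 2 = 0 := by omega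
      simp only [this, decide_not]
  have heven : n % 2 = 0 := by
    have h1 := relationGraph_adj_isLeft ((hf 0 (by omega) (n - 1) (by omega)).2
      (by unfold CyclicAdj; omega))
    rw [hpar _ (by omega), h0] at h1
    have : ¬ (n - 1) % 2 = 0 := by simpa using h1
    omega
  have hx : ∀ i, ∃ a, i < n / 2 → f (2 * i) = Sum.inl a := by
    intro i
    by_cases hi : i < n / 2
    · have := hpar (2 * i) (by omega)
      rw [decide_eq_true (by omega)] at this
      obtain ⟨a, ha⟩ := Sum.isLeft_iff.1 this
      exact ⟨a, fun _ => ha⟩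
    · obtain ⟨a, -⟩ := Sum.isLeft_iff.1 h0
      exact ⟨a, fun h => absurd h hi⟩
  have hright : ∀ i, i < n / 2 → ∃ b, f (2 * i + 1) = Sum.inr b := by
    intro i hi
    have := hpar (2 * i + 1) (by omega)
    rw [decide_eq_false (by omega)] at this
    exact Sum.isRight_iff.1 (Sum.isLeft_eq_false.1 this)
  have hy : ∀ i, ∃ b, i < n / 2 → f (2 * i + 1) = Sum.inr b := by
    intro i
    by_cases hi : i < n / 2
    · obtain ⟨b, hb⟩ := hright i hi
      exact ⟨b, fun _ => hb⟩
    · obtain ⟨b, -⟩ := hright 0 (by omega)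
      exact ⟨b, fun h => absurd h hi⟩
  choose x hx using hx
  choose y hy using hy
  refine ⟨n / 2, x, y, by omega, fun i hi j hj => ?_⟩
  have h1 := hf (2 * i) (by omega) (2 * j + 1) (by omega)
  rw [hx i hi, hy j hj] at h1
  refine h1.trans ?_
  unfold CyclicAdj SunAdj
  omega

theorem exists_isAlternatingCycle {X Y : Type*} {R : X → Y → Prop} {n : ℕ} (hn : 3 ≤ n)
    (h : (cycleGraph n).IsIndContained (relationGraph R)) :
    ∃ k x y, n = 2 * k ∧ IsAlternatingCycle R k x y := by
  obtain ⟨f, -, hf⟩ := (cycleGraph_isIndContained_iff hn).1 h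
  cases h0 : (f 0).isLeft with
  | true => exact exists_isAlternatingCycle_of_isLeft hn hf h0
  | false =>
    -- The second vertex is then in the first colour class, so the cycle is started there.
    refine exists_isAlternatingCycle_of_isLeft hn (f := f ∘ rotateIndex n 1) (fun i hi j hj => ?_) ?_
    · refine (hf _ (by unfold rotateIndex; split_ifs <;> omega) _
        (by unfold rotateIndex; split_ifs <;> omega)).trans ?_
      unfold CyclicAdj rotateIndex
      split_ifs <;> omega
    · have h1 : rotateIndex n 1 0 = 1 := if_pos (by omega)
      rw [Function.comp_apply, h1,
        relationGraph_adj_isLeft ((hf 0 (by omega) 1 (by omega)).2 (Or.inl rfl)), h0]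
      rfl

theorem IsStronglyChordal.isChordalBipartite_relationGraph {V : Type*} [Finite V]
    {G : SimpleGraph V} (hG : G.IsStronglyChordal) :
    (relationGraph G.MaximalCliqueMem).IsChordalBipartite := by
  refine ⟨(relationGraph_isBipartition _).1.isBipartite, fun n hn h => ?_⟩
  obtain ⟨k, x, y, hnk, hxy⟩ := exists_isAlternatingCycle (by omega) h
  exact hG.not_isAlternatingCycle (by omega) x y hxy

/-- Two distinct vertices are adjacent if and only if some maximal clique contains both. -/
theorem isHalfSquareOf_relationGraph {V : Type*} [Finite V] (G : SimpleGraph V) :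
    G.IsHalfSquareOf (relationGraph G.MaximalCliqueMem) := by
  refine ⟨_, _, relationGraph_isBipartition _,
    ⟨⟨Equiv.ofInjective Sum.inl Sum.inl_injective, fun {u v} => ?_⟩⟩⟩
  change (relationGraph G.MaximalCliqueMem).square.Adj (Sum.inl u) (Sum.inl v) ↔ G.Adj u v
  rw [(relationGraph_isBipartition _).1.square_adj_iff ⟨u, rfl⟩ ⟨v, rfl⟩, Ne, Sum.inl.injEq]
  constructor
  · rintro ⟨hne, C | C, hu, hv⟩
    · exact hu.elim
    · exact MaximalCliqueMem.adj hu hv hne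
  · intro h
    obtain ⟨C, hu, hv⟩ := exists_maximalCliqueMem_pair h
    exact ⟨h.ne, Sum.inr C, hu, hv⟩

end SimpleGraph

/-! ### Characterization of half-squares -/

theorem mainTheorem1 {V : Type u} [Finite V] (G : SimpleGraph V) :
    (∃ (U : Type u) (_ : Finite U) (B : SimpleGraph U),
      B.IsChordalBipartite ∧ G.IsHalfSquareOf B) ↔ G.IsStronglyChordal :=
  ⟨fun ⟨_, _, _, hC, hG⟩ => hC.isStronglyChordal hG, fun hG =>
    ⟨_, inferInstance, _, hG.isChordalBipartite_relationGraph, G.isHalfSquareOf_relationGraph⟩⟩
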